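/- Let $\Gamma=(V,E)$ be a finite simple graph. A matching $M\subseteq E$ in $\Gamma$ (a set of pairwise disjoint edges) is called positive if there is a weight function $w\colon V\to\mathbb{R}$ such that, for every edge $uv\in E$, $w(u)+w(v)>0$ if and only if $uv\in M$. A positive matching decomposition of $\Gamma$ with $p$ parts is an ordered partition $E_1,\ldots,E_p$ of $E$ such that $E_i$ is a positive matching of $\bigl(V,E\setminus\bigcup_{j=1}^{i-1}E_j\bigr)$ for every $i=1,\ldots,p$; the smallest $p$ for which such a decomposition exists is denoted by $\mathrm{pmd}(\Gamma)$. For integers $m\ge 2$ and even $n\ge 4$, the circular wall graph $CW(m,n)$ is the graph with vertex set $\{1,\ldots,m\}\times\{1,\ldots,n\}$ obtained from the Cartesian product $P_m\square C_n$ of the path $1,2,\ldots,m$ and the cycle $1,2,\ldots,n,1$ by removing the edges $\{(i,j),(i+1,j)\}$, $1\le i<m$, $1\le j\le n$, for which $i+j$ is odd. Proposition. If $m\ge 2$, and $n\ge 4$ is even, then \[ \mathrm{pmd}(CW(m,n))=\begin{cases}3, & n>2m,\\ 4, & n\le 2m.\end{cases} \] -/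

import Mathlib

namespace PosMatch

/-- A set `M` of edges of `G` is a matching: two distinct members of `M` have no common vertex. -/
def IsEdgeMatching {V : Type*} (G : SimpleGraph V) (M : Set (Sym2 V)) : Prop :=
  M ⊆ G.edgeSet ∧ ∀ e ∈ M, ∀ e' ∈ M, e ≠ e' → ∀ v : V, ¬(v ∈ e ∧ v ∈ e')

/-- A matching `M` of `G` is positive if for some weight function `w` on the vertices, the edges
`uv` of `G` with `w u + w v > 0` are exactly the members of `M`. -/
def IsPositiveMatching {V : Type*} (G : SimpleGraph V) (M : Set (Sym2 V)) : Prop :=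
  IsEdgeMatching G M ∧
    ∃ w : V → ℝ, ∀ u v : V, G.Adj u v → (0 < w u + w v ↔ s(u, v) ∈ M)

/-- A positive matching decomposition of `G` with `p` parts: an ordered partition
`E 0, …, E (p - 1)` of the edge set such that each `E i` is a positive matching of the graph
obtained from `G` by removing the edges in the earlier parts. -/
structure IsPMD {V : Type*} (G : SimpleGraph V) {p : ℕ} (E : Fin p → Set (Sym2 V)) : Prop where
  nonempty : ∀ i, (E i).Nonempty
  disjoint : ∀ i j, i ≠ j → Disjoint (E i) (E j)
  union_eq : (⋃ i, E i) = G.edgeSet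
  positive : ∀ i, IsPositiveMatching (G.deleteEdges (⋃ j, ⋃ (_ : j < i), E j)) (E i)

/-- The smallest number of parts of a positive matching decomposition of a finite graph. (Such
decompositions exist: take the single edges as parts, in any order.) -/
noncomputable def pmd {V : Type*} [Finite V] (G : SimpleGraph V) : ℕ :=
  sInf {p : ℕ | ∃ E : Fin p → Set (Sym2 V), IsPMD G E}

open SimpleGraph in
/-- The circular wall graph `CW(m, n)`: the Cartesian product of the path on `m` vertices and the
cycle on `n` vertices, without the edges `{(i, j), (i + 1, j)}` with `i + j` odd. Here `i` and `j`
are counted from `0`; counting both from `1` gives the same parity of `i + j`. -/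
def circularWall (m n : ℕ) : SimpleGraph (Fin m × Fin n) :=
  (pathGraph m □ cycleGraph n).deleteEdges
    {e | ∃ (i i' : Fin m) (j : Fin n), (i' : ℕ) = (i : ℕ) + 1 ∧ Odd ((i : ℕ) + (j : ℕ)) ∧
      e = s((i, j), (i', j))}

end PosMatch

namespace PosMatch

/-! Call (i, j) white if i + j is even and black otherwise, with rows numbered downwards; a vertical
edge has a white upper and a black lower end. The obstruction to positivity is a closed walk
alternating between edges of positive and of nonpositive weight sum: the weight at every second
vertex would strictly decrease along it.

The ends of a vertical edge have degree three, so p ≥ 3, and if p = 3 every part covers them. Let p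
= 3 and n ≤ 2m. The first part has no two horizontal edges stacked in adjacent rows (`not_stacked`).
Hence its edges going right from black vertices repeat along diagonals, and those going left along
antidiagonals (`right_iff`, `left_iff`). As n ≤ 2m, these lines meet inside the wall, so only one
kind occurs (`not_left_of_right`). A walk up through vertical edges and back down a diagonal is then
alternating and closed (`false_of_right`). So the first part misses row 0, whose cycle alternates
between the other two parts, which is again impossible (`exists_hor_mem_zero`).

The upper bounds come from explicit weights. With four parts, remove the vertical edges first and
then decompose the remaining n-cycles. If n > 2m, the first part can be a single diagonal of right
edges together with the vertical edges disjoint from it; what remains is one path through all rows,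
which needs two parts. -/

/-! ### The first of three parts: propagation along diagonals -/

/-- Real weights on the strip `{0, …, m - 1} × ℤ`, periodic in the second coordinate, whose positive
edges behave like the first part of a positive matching decomposition with three parts. -/
structure WallWeight (m n : ℕ) (W : ℕ → ℤ → ℝ) : Prop where
  periodic : ∀ i j, W i (j + n) = W i j
  not_hor_hor : ∀ i j, i < m → 0 < W i j + W i (j + 1) → W i (j + 1) + W i (j + 2) ≤ 0
  ver_above : ∀ (i : ℕ) (j : ℤ), i + 1 < m → Even (i + j) → 0 < W i j + W (i + 1) j →
    W i j + W i (j + 1) ≤ 0 ∧ W i (j - 1) + W i j ≤ 0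
  ver_below : ∀ (i : ℕ) (j : ℤ), i + 1 < m → Even (i + j) → 0 < W i j + W (i + 1) j →
    W (i + 1) j + W (i + 1) (j + 1) ≤ 0 ∧ W (i + 1) (j - 1) + W (i + 1) j ≤ 0
  -- Covering is demanded only at ends of vertical edges, which have degree three.
  cover_white : ∀ (i : ℕ) (j : ℤ), i + 1 < m → Even (i + j) →
    0 < W i j + W i (j + 1) ∨ 0 < W i (j - 1) + W i j ∨ 0 < W i j + W (i + 1) j
  cover_black : ∀ (i : ℕ) (j : ℤ), i + 1 < m → Even (i + j) →
    0 < W (i + 1) j + W (i + 1) (j + 1) ∨ 0 < W (i + 1) (j - 1) + W (i + 1) j ∨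
      0 < W i j + W (i + 1) j

/-- A periodic sequence has no alternating closed walk. -/
theorem not_alternating_of_periodic {n : ℕ} (hn : 0 < n) {g : ℤ → ℝ}
    (hg : ∀ j, g (j + n) = g j) (j : ℤ)
    (hpos : ∀ t : ℕ, 0 < g (j + 2 * t) + g (j + 2 * t + 1))
    (hneg : ∀ t : ℕ, g (j + 2 * t + 1) + g (j + 2 * t + 2) ≤ 0) : False := by
  have hanti : StrictAnti fun t : ℕ => g (j + 2 * t) := by
    refine strictAnti_nat_of_succ_lt fun t => ?_
    have h1 := hpos t
    have h2 := hneg t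
    have h3 : j + 2 * ((t + 1 : ℕ) : ℤ) = j + 2 * t + 2 := by push_cast; ring
    simp only [h3]
    linarith
  -- Going n double steps means two full turns, so no parity of n is needed.
  have h := hanti hn
  have h2 : j + 2 * ((n : ℕ) : ℤ) = j + n + n := by ring
  simp only [h2, hg] at h
  simp at h

namespace WallWeight

variable {m n : ℕ} {W : ℕ → ℤ → ℝ}

/-- The mirror image j ↦ -j preserves the parity of i + j; it exchanges right and left edges. -/
theorem reflect (h : WallWeight m n W) : WallWeight m n fun i j => W i (-j) where
  periodic i j := by
    have := h.periodic i (-(j + n))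
    rw [← this]; congr 1; ring
  not_hor_hor i j hi hp := by
    by_contra! hc
    have := h.not_hor_hor i (-(j + 2)) hi
    rw [show -(j + 2) + 1 = -(j + 1) by ring, show -(j + 2) + 2 = -j by ring] at this
    linarith [this (by linarith)]
  ver_above i j hi he hp := by
    have := h.ver_above i (-j) hi (by grind) hp
    rw [show -(j + 1) = -j - 1 by ring, show -(j - 1) = -j + 1 by ring]
    constructor <;> linarith [this.1, this.2]
  ver_below i j hi he hp := by
    have := h.ver_below i (-j) hi (by grind) hp
    rw [show -(j + 1) = -j - 1 by ring, show -(j - 1) = -j + 1 by ring]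
    constructor <;> linarith [this.1, this.2]
  cover_white i j hi he := by
    have := h.cover_white i (-j) hi (by grind)
    rw [show -(j + 1) = -j - 1 by ring, show -(j - 1) = -j + 1 by ring,
      add_comm (W i (-j)) (W i (-j - 1)), add_comm (W i (-j + 1)) (W i (-j))]
    tauto
  cover_black i j hi he := by
    have := h.cover_black i (-j) hi (by grind)
    rw [show -(j + 1) = -j - 1 by ring, show -(j - 1) = -j + 1 by ring,
      add_comm (W (i + 1) (-j)) (W (i + 1) (-j - 1)),
      add_comm (W (i + 1) (-j + 1)) (W (i + 1) (-j))]
    tauto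

/-- A stacked pair forces the next one two columns to the right, so row i would carry an alternating
closed walk. -/
theorem not_stacked_of_even (h : WallWeight m n W) (hn : 0 < n) {i : ℕ} {j : ℤ} (hi : i + 1 < m)
    (he : Even (i + j)) (h0 : 0 < W i j + W i (j + 1))
    (h1 : 0 < W (i + 1) j + W (i + 1) (j + 1)) : False := by
  have key : ∀ t : ℕ, 0 < W i (j + 2 * t) + W i (j + 2 * t + 1) ∧
      0 < W (i + 1) (j + 2 * t) + W (i + 1) (j + 2 * t + 1) := by
    intro t
    induction t with
    | zero => simpa using ⟨h0, h1⟩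
    | succ t ih =>
      obtain ⟨k, hk⟩ : ∃ k, k = j + 2 * t := ⟨_, rfl⟩
      rw [show j + 2 * ((t + 1 : ℕ) : ℤ) = k + 2 by rw [hk]; push_cast; ring]
      rw [← hk] at ih
      have hke : Even (i + k) := by rw [hk]; grind
      have hke' : Even (i + (k + 2)) := by grind
      have n0 := h.not_hor_hor i k (by omega) ih.1
      have n1 := h.not_hor_hor (i + 1) k hi ih.2
      have nv : W i k + W (i + 1) k ≤ 0 := by
        by_contra! hc
        linarith [(h.ver_above i k hi hke hc).1, ih.1]
      -- Otherwise the hexagon on columns k, k + 1, k + 2 would alternate. With both left edges and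
      -- the vertical edge excluded, the ends in column k + 2 must be covered to the right.
      have nv2 : W i (k + 2) + W (i + 1) (k + 2) ≤ 0 := by
        linarith [ih.1, ih.2]
      have c0 := h.cover_white i (k + 2) hi hke'
      have c1 := h.cover_black i (k + 2) hi hke'
      rw [show k + 2 - 1 = k + 1 by ring] at c0 c1
      constructor
      · rcases c0 with c | c | c
        · exact c
        · linarith
        · linarith
      · rcases c1 with c | c | c
        · exact c
        · linarith
        · linarith
  exact not_alternating_of_periodic hn (h.periodic i) j (fun t => (key t).1)
    fun t => h.not_hor_hor i _ (by omega) (key t).1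

theorem not_stacked (h : WallWeight m n W) (hn : 0 < n) {i : ℕ} {j : ℤ} (hi : i + 1 < m)
    (h0 : 0 < W i j + W i (j + 1)) (h1 : 0 < W (i + 1) j + W (i + 1) (j + 1)) : False := by
  rcases Int.even_or_odd (i + j) with he | ho
  · exact h.not_stacked_of_even hn hi he h0 h1
  · refine h.reflect.not_stacked_of_even hn (i := i) (j := -(j + 1)) hi (by grind) ?_ ?_
    · simp only [show -(-(j + 1)) = j + 1 by ring, show -(-(j + 1) + 1) = j by ring]
      linarith
    · simp only [show -(-(j + 1)) = j + 1 by ring, show -(-(j + 1) + 1) = j by ring]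
      linarith

/-- The vertical edge in column j + 1 is either in the matching or both its ends are covered
horizontally; in the latter case they are covered on opposite sides, since the same side would give
a stacked pair. -/
theorem right_succ (h : WallWeight m n W) (hn : 0 < n) {i : ℕ} {j : ℤ} (hi : i + 1 < m)
    (ho : Odd (i + j)) :
    0 < W (i + 1) (j + 1) + W (i + 1) (j + 2) ↔ 0 < W i j + W i (j + 1) := by
  have he : Even (i + (j + 1)) := by grind
  have h1 : j + 1 + 1 = j + 2 := by ring
  have h2 : j + 1 - 1 = j := by ring
  have va := h.ver_above i (j + 1) hi he
  have vb := h.ver_below i (j + 1) hi he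
  have cw := h.cover_white i (j + 1) hi he
  have cb := h.cover_black i (j + 1) hi he
  have s1 := fun a b => h.not_stacked hn (i := i) (j := j) hi a b
  have s2 := fun a b => h.not_stacked hn (i := i) (j := j + 1) hi a b
  rw [h1, h2] at va vb cw cb
  rw [h1] at s2
  constructor
  · intro hp
    rcases cw with c | c | c
    · exact (s2 c hp).elim
    · exact c
    · linarith [(vb c).1]
  · intro hp
    rcases cb with c | c | c
    · exact c
    · exact (s1 hp c).elim
    · linarith [(va c).2]

theorem right_iff (h : WallWeight m n W) (hn : 0 < n) {j : ℤ} (ho : Odd j) :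
    ∀ i : ℕ, i < m → (0 < W i (j + i) + W i (j + i + 1) ↔ 0 < W 0 j + W 0 (j + 1)) := by
  intro i
  induction i with
  | zero => simp
  | succ i ih =>
    intro hi
    have := h.right_succ hn (i := i) (j := j + i) hi (by grind)
    rw [← ih (by omega), ← this]
    push_cast
    rw [show j + (i + 1 : ℤ) = j + i + 1 by ring, show j + (i : ℤ) + 1 + 1 = j + i + 2 by ring]

theorem left_iff (h : WallWeight m n W) (hn : 0 < n) {j : ℤ} (ho : Odd j) (i : ℕ) (hi : i < m) :
    0 < W i (j - i - 1) + W i (j - i) ↔ 0 < W 0 (j - 1) + W 0 j := by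
  have := h.reflect.right_iff hn (j := -j) (by grind) i hi
  simp only [show -(-j + (i : ℤ)) = j - i by ring, show -(-j + (i : ℤ) + 1) = j - i - 1 by ring,
    neg_neg, show -(-j + 1) = j - 1 by ring] at this
  rw [add_comm (W i (j - i - 1)), add_comm (W 0 (j - 1))]
  exact this

theorem periodic_mul (h : WallWeight m n W) (i : ℕ) (j q : ℤ) : W i (j + n * q) = W i j := by
  have hp : Function.Periodic (W i) (n : ℤ) := h.periodic i
  have := hp.int_mul q j
  rw [mul_comm]; exact this

/-- The diagonal from c and the antidiagonal from d ≡ c + 2s, with 0 ≤ s < n / 2 ≤ m, would reach a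
common vertex within m rows, and that vertex would lie on two positive edges. -/
theorem not_left_of_right (h : WallWeight m n W) (hn : 0 < n) (hne : Even n) (hnm : n ≤ 2 * m)
    {c d : ℤ} (hc : Odd c) (hd : Odd d) (hr : 0 < W 0 c + W 0 (c + 1)) :
    W 0 (d - 1) + W 0 d ≤ 0 := by
  by_contra! hl
  obtain ⟨N, hN⟩ := hne
  obtain ⟨x, hx⟩ : ∃ x : ℤ, d - c = 2 * x := by
    obtain ⟨a, ha⟩ := hc; obtain ⟨b, hb⟩ := hd; exact ⟨b - a, by omega⟩
  have hN0 : (0 : ℤ) < N := by omega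
  obtain ⟨s, hs⟩ : ∃ s : ℕ, (s : ℤ) = x % N := ⟨(x % N).toNat, by
    have := Int.emod_nonneg x hN0.ne'; omega⟩
  have hsN : (s : ℤ) < N := hs ▸ Int.emod_lt_of_pos x hN0
  have hdc : d = c + 2 * s + n * (x / N) := by
    have := Int.emod_add_mul_ediv x N
    rw [← hs] at this
    rw [hN]; push_cast; linarith
  have hl' : 0 < W 0 (c + 2 * s - 1) + W 0 (c + 2 * s) := by
    rw [hdc, h.periodic_mul, show c + 2 * (s : ℤ) + n * (x / N) - 1
      = c + 2 * s - 1 + n * (x / N) by ring, h.periodic_mul] at hl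
    exact hl
  rcases Nat.eq_zero_or_pos s with h0 | h0
  · subst h0
    have := h.not_hor_hor 0 (c - 1) (by omega)
    rw [show c - 1 + 1 = c by ring, show c - 1 + 2 = c + 1 by ring] at this
    simp at hl'
    linarith [this hl']
  -- In row i = s - 1 both edges end in column c + i + 1.
  · obtain ⟨i, rfl⟩ : ∃ i, s = i + 1 := ⟨s - 1, by omega⟩
    have hi : i < m := by omega
    have r := (h.right_iff hn hc i hi).2 hr
    have l := (h.left_iff hn (j := c + 2 * ((i + 1 : ℕ) : ℤ)) (by grind) i hi).2 hl'
    have := h.not_hor_hor i _ hi r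
    rw [show c + 2 * ((i + 1 : ℕ) : ℤ) - i - 1 = c + i + 1 by push_cast; ring,
      show c + 2 * ((i + 1 : ℕ) : ℤ) - i = c + i + 2 by push_cast; ring] at l
    linarith

/-- With left edges excluded, a black vertex below row 0 is matched to the right if its diagonal
carries right edges, and upwards otherwise. Following these edges for one turn and closing up along
the diagonal of c gives an alternating closed walk. -/
theorem false_of_right (h : WallWeight m n W) (hn : 0 < n) (hne : Even n) (hnm : n ≤ 2 * m)
    {c : ℤ} (hc : Odd c) (hr : 0 < W 0 c + W 0 (c + 1)) : False := by
  classical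
  obtain ⟨N, hN⟩ := id hne
  set P : ℕ → Prop := fun t => 0 < W 0 (c + 2 * t) + W 0 (c + 2 * t + 1) with hP
  -- The row of the walk at diagonal t: the number of upward moves still to come, so that the walk
  -- ends in row 0. It starts inside the wall because `P 0` holds and N ≤ m.
  set ρ : ℕ → ℕ := fun t => ((Finset.Ico t N).filter fun s => ¬ P s).card with hρ
  have hodd : ∀ t : ℕ, Odd (c + 2 * t) := fun t => by grind
  have hP0 : P 0 := by simpa [hP] using hr
  have hρ0 : ρ 0 < m := by
    have : (Finset.Ico 0 N).filter (fun s => ¬ P s) ⊂ Finset.Ico 0 N :=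
      Finset.filter_ssubset.2 ⟨0, by simp; omega, by simpa using hP0⟩
    have := Finset.card_lt_card this
    simp only [Nat.card_Ico] at this
    simp only [hρ]; omega
  have hρN : ρ N = 0 := by simp [hρ]
  have hsucc : ∀ t, t < N → ρ t = ρ (t + 1) + if P t then 0 else 1 := by
    intro t ht
    simp only [hρ]
    rw [← Finset.insert_Ico_succ_left_eq_Ico ht, Finset.filter_insert]
    by_cases hp : P t
    · simp [hp, Order.succ_eq_add_one]
    · rw [if_pos hp, if_neg hp, Finset.card_insert_of_notMem (by simp), Order.succ_eq_add_one]
  have hle : ∀ t, t ≤ N → ρ t ≤ ρ 0 := fun t _ =>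
    Finset.card_le_card (Finset.filter_subset_filter _ (Finset.Ico_subset_Ico_left (Nat.zero_le t)))
  -- potential of black vertices
  set f : ℕ → ℕ → ℝ := fun i t => - W i (c + 2 * t + i) with hf
  -- On the diagonal of c the right edge is positive, so the vertical edge at its white end is not.
  have hdown : ∀ i, i + 1 < m → f i 0 ≤ f (i + 1) 0 := by
    intro i hi
    have r := (h.right_iff hn hc i (by omega)).2 hr
    have v : W i (c + i + 1) + W (i + 1) (c + i + 1) ≤ 0 := by
      by_contra! hv
      have := (h.ver_above i (c + i + 1) hi (by grind) hv).2
      rw [show c + (i : ℤ) + 1 - 1 = c + i by ring] at this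
      linarith
    simp only [hf]
    push_cast
    rw [add_zero, ← add_assoc]
    linarith
  have hdown' : ∀ i, i < m → f 0 0 ≤ f i 0 := by
    intro i
    induction i with
    | zero => simp
    | succ i ih => exact fun hi => (ih (by omega)).trans (hdown i hi)
  -- One positive edge to a white vertex, rightwards or upwards, then a nonpositive edge to the
  -- right.
  have hstep : ∀ t, t < N → f (ρ t) t < f (ρ (t + 1)) (t + 1) := by
    intro t ht
    have hm := (hle t ht.le).trans_lt hρ0
    have hs := hsucc t ht
    by_cases hp : P t
    · rw [if_pos hp, add_zero] at hs
      rw [← hs]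
      have r := (h.right_iff hn (hodd t) (ρ t) hm).2 hp
      have := h.not_hor_hor _ _ hm r
      simp only [hf]
      push_cast
      rw [show c + 2 * ((t : ℤ) + 1) + (ρ t : ℤ) = c + 2 * t + ρ t + 2 by ring]
      linarith
    · rw [if_neg hp] at hs
      obtain ⟨i, hi⟩ : ∃ i, i = ρ (t + 1) := ⟨_, rfl⟩
      rw [← hi] at hs ⊢
      rw [hs] at hm ⊢
      set k : ℤ := c + 2 * t + i + 1 with hk
      have hke : Even (i + k) := by rw [hk]; grind
      have v : 0 < W i k + W (i + 1) k := by
        rcases h.cover_black i k hm hke with r | l | v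
        · refine (hp ?_).elim
          have := (h.right_iff hn (hodd t) (i + 1) hm).1
          push_cast at this
          rw [show c + 2 * (t : ℤ) + (i + 1 : ℤ) = k by rw [hk]; ring] at this
          exact this r
        · have hk' : Odd (k + i + 1) := by rw [hk]; grind
          have := (h.left_iff hn hk' (i + 1) hm).1
          push_cast at this
          rw [show k + i + 1 - (i + 1 : ℤ) = k by ring] at this
          linarith [this l, h.not_left_of_right hn hne hnm hc hk' hr]
        · exact v
      have := (h.ver_above i k hm hke v).1
      simp only [hf]
      push_cast
      rw [show c + 2 * (t : ℤ) + (i + 1 : ℤ) = k by rw [hk]; ring,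
        show c + 2 * ((t : ℤ) + 1) + i = k + 1 by rw [hk]; ring]
      linarith
  have hmono : ∀ t, t ≤ N → f (ρ 0) 0 ≤ f (ρ t) t := by
    intro t
    induction t with
    | zero => simp
    | succ t ih => exact fun ht => (ih (by omega)).trans (hstep t ht).le
  obtain ⟨M, rfl⟩ : ∃ M, N = M + 1 := ⟨N - 1, by omega⟩
  have h1 := (hmono M (by omega)).trans_lt (hstep M (by omega))
  have h2 : f 0 (M + 1) = f 0 0 := by
    simp only [hf]
    have := h.periodic 0 c
    rw [hN] at this
    push_cast at this ⊢
    rw [show c + 2 * ((M : ℤ) + 1) + 0 = c + (M + 1 + (M + 1)) by ring, this]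
    simp
  rw [hρN, h2] at h1
  exact absurd (hdown' _ hρ0) (not_le.2 h1)

theorem hor_nonpos (h : WallWeight m n W) (hn : 0 < n) (hne : Even n) (hnm : n ≤ 2 * m) (j : ℤ) :
    W 0 j + W 0 (j + 1) ≤ 0 := by
  by_contra! hr
  rcases Int.even_or_odd j with he | ho
  · refine h.reflect.false_of_right hn hne hnm (c := -(j + 1)) (by grind) ?_
    simp only [show -(-(j + 1)) = j + 1 by ring, show -(-(j + 1) + 1) = j by ring]
    linarith
  · exact h.false_of_right hn hne hnm ho hr

end WallWeight
-- Decompositions from coloured arcs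
/-- A positive matching decomposition from a colouring of the arcs of an orientation of `G` and
weights: the colour of an arc is the first index at which the weights of its ends have a positive
sum, and each colour occurs at most once at each vertex. -/
theorem isPMD_of_arcs {V : Type*} (G : SimpleGraph V) {p : ℕ} (r : V → V → Prop)
    (hr : ∀ x y, G.Adj x y ↔ r x y ∨ r y x) (c : V → V → Fin p) (w : Fin p → V → ℤ)
    (hpos : ∀ x y, r x y → 0 < w (c x y) x + w (c x y) y)
    (hneg : ∀ x y, r x y → ∀ k < c x y, w k x + w k y ≤ 0)
    (hout : ∀ x y z, r x y → r x z → c x y = c x z → y = z)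
    (hin : ∀ x y z, r x z → r y z → c x z = c y z → x = y)
    (hmid : ∀ x y z, r x y → r y z → c x y = c y z → x = z)
    (hne : ∀ k, ∃ x y, r x y ∧ c x y = k) :
    IsPMD G fun k => {e | ∃ x y, r x y ∧ c x y = k ∧ e = s(x, y)} := by
  have hlt : ∀ x y x' y', r x y → r x' y' → s(x, y) = s(x', y') → ¬ c x y < c x' y' := by
    intro x y x' y' h h' he hlt
    have h1 := hpos x y h
    have h2 := hneg x' y' h' _ hlt
    rcases Sym2.eq_iff.1 he with ⟨rfl, rfl⟩ | ⟨rfl, rfl⟩ <;> omega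
  have hcol : ∀ x y x' y', r x y → r x' y' → s(x, y) = s(x', y') → c x y = c x' y' := by
    intro x y x' y' h h' he
    exact le_antisymm (not_lt.1 (hlt _ _ _ _ h' h he.symm)) (not_lt.1 (hlt _ _ _ _ h h' he))
  refine ⟨fun k => ?_, fun k l hkl => ?_, ?_, fun k => ⟨⟨?_, ?_⟩, fun x => (w k x : ℝ), ?_⟩⟩
  · obtain ⟨x, y, h, hc⟩ := hne k
    exact ⟨s(x, y), x, y, h, hc, rfl⟩
  · rw [Set.disjoint_left]
    rintro e ⟨x, y, h, rfl, rfl⟩ ⟨x', y', h', rfl, he⟩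
    exact hkl (hcol _ _ _ _ h h' he)
  · ext e
    induction e with | _ x y
    rw [SimpleGraph.mem_edgeSet, hr, Set.mem_iUnion]
    constructor
    · rintro ⟨k, x', y', h, -, he⟩
      rcases Sym2.eq_iff.1 he with ⟨rfl, rfl⟩ | ⟨rfl, rfl⟩
      exacts [Or.inl h, Or.inr h]
    · rintro (h | h)
      exacts [⟨_, x, y, h, rfl, rfl⟩, ⟨_, y, x, h, rfl, Sym2.eq_swap⟩]
  · rintro e ⟨x, y, h, rfl, rfl⟩
    rw [SimpleGraph.mem_edgeSet, SimpleGraph.deleteEdges_adj, hr]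
    refine ⟨Or.inl h, ?_⟩
    simp only [Set.mem_iUnion, not_exists]
    rintro l hl ⟨x', y', h', rfl, he⟩
    exact hlt _ _ _ _ h' h he.symm hl
  · rintro e ⟨x, y, h, hk, rfl⟩ e' ⟨x', y', h', hk', rfl⟩ hee v ⟨hv, hv'⟩
    rw [Sym2.mem_iff] at hv hv'
    apply hee
    have hc := hk.trans hk'.symm
    rcases hv with rfl | rfl <;> rcases hv' with rfl | rfl
    · rw [hout _ _ _ h h' hc]
    · rw [hmid _ _ _ h' h hc.symm, Sym2.eq_swap]
    · rw [hmid _ _ _ h h' hc, Sym2.eq_swap]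
    · rw [hin _ _ _ h h' hc]
  · have key : ∀ x y, r x y → s(x, y) ∉ (⋃ l, ⋃ (_ : l < k),
        {e | ∃ x y, r x y ∧ c x y = l ∧ e = s(x, y)}) →
        (0 < w k x + w k y ↔ s(x, y) ∈ {e | ∃ x y, r x y ∧ c x y = k ∧ e = s(x, y)}) := by
      intro x y h hn
      simp only [Set.mem_iUnion, not_exists] at hn
      have hk : k ≤ c x y := not_lt.1 fun hlt => hn _ hlt ⟨x, y, h, rfl, rfl⟩
      constructor
      · intro h0
        refine ⟨x, y, h, ?_, rfl⟩
        by_contra hne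
        have := hneg x y h k (lt_of_le_of_ne hk (Ne.symm hne))
        omega
      · rintro ⟨x', y', h', rfl, he⟩
        rw [← hcol _ _ _ _ h h' he]
        exact hpos x y h
    intro x y hxy
    rw [SimpleGraph.deleteEdges_adj, hr] at hxy
    rcases hxy with ⟨h | h, hn⟩
    · rw [← key x y h hn]
      simp only [← Int.cast_add, Int.cast_pos]
    · rw [Sym2.eq_swap] at hn ⊢
      rw [← key y x h hn, add_comm]
      simp only [← Int.cast_add, Int.cast_pos]

/-- The edges of the circular wall, each in one direction. -/
def WallArc {m n : ℕ} (x y : Fin m × Fin n) : Prop :=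
  ((x.1 : ℕ) = y.1 ∧ (x.2 : ℕ) + 1 = y.2) ∨
  ((x.1 : ℕ) = y.1 ∧ (x.2 : ℕ) + 1 = n ∧ (y.2 : ℕ) = 0) ∨
  ((x.1 : ℕ) + 1 = y.1 ∧ (x.2 : ℕ) = y.2 ∧ ((x.1 : ℕ) + x.2) % 2 = 0)

theorem circularWall_adj {m n : ℕ} (hn : 4 ≤ n) (x y : Fin m × Fin n) :
    (circularWall m n).Adj x y ↔ WallArc x y ∨ WallArc y x := by
  obtain ⟨i, j⟩ := x
  obtain ⟨i', j'⟩ := y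
  have sub_val : ∀ u v : Fin n, (u - v).val = 1 ↔
      (v : ℕ) + 1 = u ∨ ((v : ℕ) + 1 = n ∧ (u : ℕ) = 0) := by
    intro u v
    have hu := u.2
    have hv := v.2
    rw [Fin.sub_def]
    rcases le_or_gt (v : ℕ) u with h | h
    · have : (n - (v : ℕ) + u) % n = u - v := by
        rw [show n - (v : ℕ) + u = (u - v) + n by omega, Nat.add_mod_right,
          Nat.mod_eq_of_lt (by omega)]
      simp only [this]; omega
    · have : (n - (v : ℕ) + u) % n = n - v + u := Nat.mod_eq_of_lt (by omega)
      simp only [this]; omega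
  have del : s((i, j), (i', j')) ∈ {e : Sym2 (Fin m × Fin n) | ∃ (i i' : Fin m) (j : Fin n),
      (i' : ℕ) = (i : ℕ) + 1 ∧ Odd ((i : ℕ) + (j : ℕ)) ∧ e = s((i, j), (i', j))} ↔
      (j : ℕ) = j' ∧ (((i' : ℕ) = i + 1 ∧ ((i : ℕ) + j) % 2 = 1) ∨
        ((i : ℕ) = i' + 1 ∧ ((i' : ℕ) + j) % 2 = 1)) := by
    simp only [Set.mem_ofPred_eq, Sym2.eq_iff, Prod.mk.injEq, Nat.odd_iff]
    constructor
    · rintro ⟨a, b, k, h, h', ⟨⟨rfl, rfl⟩, rfl, rfl⟩ | ⟨⟨rfl, rfl⟩, rfl, rfl⟩⟩ <;> simp [h, h']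
    · rintro ⟨h, ⟨h', h''⟩ | ⟨h', h''⟩⟩
      · exact ⟨i, i', j, h', h'', Or.inl ⟨⟨rfl, rfl⟩, rfl, (Fin.ext h).symm⟩⟩
      · exact ⟨i', i, j, h', h'', Or.inr ⟨⟨rfl, rfl⟩, rfl, (Fin.ext h).symm⟩⟩
  rw [circularWall, SimpleGraph.deleteEdges_adj, del, SimpleGraph.boxProd_adj,
    SimpleGraph.pathGraph_adj, SimpleGraph.cycleGraph_adj', sub_val, sub_val]
  simp only [WallArc, Fin.ext_iff]
  generalize (i : ℕ) = a, (i' : ℕ) = b, (j : ℕ) = c, (j' : ℕ) = d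
  rcases lt_trichotomy a b with h | rfl | h
  · by_cases h1 : a + 1 = b <;> by_cases h2 : c = d <;> grind
  · grind
  · by_cases h1 : b + 1 = a <;> by_cases h2 : c = d <;> grind

/-! ### Four parts always suffice -/

theorem exists_isPMD_four {m n : ℕ} (hm : 2 ≤ m) (hn : 4 ≤ n) (hne : Even n) :
    ∃ E : Fin 4 → Set (Sym2 (Fin m × Fin n)), IsPMD (circularWall m n) E := by
  obtain ⟨N, hN⟩ := hne
  refine ⟨_, isPMD_of_arcs _ WallArc (circularWall_adj hn)
    -- Vertical edges get colour 0. In each row the edge between columns 0 and 1 gets colour 1,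
    -- which opens the cycle into a path coloured alternately 2 and 3.
    (fun x y => if (x.1 : ℕ) = y.1 then
      if (x.2 : ℕ) = 0 then 1 else if (x.2 : ℕ) % 2 = 1 then 2 else 3 else 0)
    -- In the first weight horizontal sums are 0 and vertical sums 1; the third is, up to sign, a
    -- position along the opened row.
    ![fun x => if ((x.1 : ℕ) + x.2) % 2 = 0 then - (x.1 : ℤ) else x.1,
      fun x => if (x.2 : ℕ) ≤ 1 then 1 else -1,
      fun x => if (x.2 : ℕ) = 0 then n - 1 else
        if (x.2 : ℕ) % 2 = 1 then 1 - (x.2 : ℤ) else x.2 - 1,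
      fun _ => 1] ?_ ?_ ?_ ?_ ?_ ?_⟩
  · rintro ⟨⟨i, hi⟩, ⟨j, hj⟩⟩ ⟨⟨i', hi'⟩, ⟨j', hj'⟩⟩ h
    dsimp only
    rcases h with ⟨h, h'⟩ | ⟨h, h', h''⟩ | ⟨h, h', h''⟩ <;>
      dsimp only at * <;> split_ifs <;> simp <;> grind
  · rintro ⟨⟨i, hi⟩, ⟨j, hj⟩⟩ ⟨⟨i', hi'⟩, ⟨j', hj'⟩⟩ h k
    rcases h with ⟨h, h'⟩ | ⟨h, h', h''⟩ | ⟨h, h', h''⟩ <;>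
      fin_cases k <;> dsimp only at * <;> simp <;> grind
  · rintro ⟨⟨i, hi⟩, ⟨j, hj⟩⟩ ⟨⟨i', hi'⟩, ⟨j', hj'⟩⟩ ⟨⟨i₁, hi₁⟩, ⟨j₁, hj₁⟩⟩ h h₁ hc
    rcases h with ⟨h, h'⟩ | ⟨h, h', h''⟩ | ⟨h, h', h''⟩ <;>
      rcases h₁ with ⟨h₁, h₁'⟩ | ⟨h₁, h₁', h₁''⟩ | ⟨h₁, h₁', h₁''⟩ <;>
      dsimp only at * <;> simp only [Prod.mk.injEq, Fin.mk.injEq] <;> grind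
  · rintro ⟨⟨i, hi⟩, ⟨j, hj⟩⟩ ⟨⟨i', hi'⟩, ⟨j', hj'⟩⟩ ⟨⟨i₁, hi₁⟩, ⟨j₁, hj₁⟩⟩ h h₁ hc
    rcases h with ⟨h, h'⟩ | ⟨h, h', h''⟩ | ⟨h, h', h''⟩ <;>
      rcases h₁ with ⟨h₁, h₁'⟩ | ⟨h₁, h₁', h₁''⟩ | ⟨h₁, h₁', h₁''⟩ <;>
      dsimp only at * <;> simp only [Prod.mk.injEq, Fin.mk.injEq] <;> grind
  · rintro ⟨⟨i, hi⟩, ⟨j, hj⟩⟩ ⟨⟨i', hi'⟩, ⟨j', hj'⟩⟩ ⟨⟨i₁, hi₁⟩, ⟨j₁, hj₁⟩⟩ h h₁ hc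
    rcases h with ⟨h, h'⟩ | ⟨h, h', h''⟩ | ⟨h, h', h''⟩ <;>
      rcases h₁ with ⟨h₁, h₁'⟩ | ⟨h₁, h₁', h₁''⟩ | ⟨h₁, h₁', h₁''⟩ <;>
      dsimp only at * <;> simp only [Prod.mk.injEq, Fin.mk.injEq] <;> grind
  · have hor : ∀ j (hj : j + 1 < n), WallArc ((⟨0, by omega⟩, ⟨j, by omega⟩) : Fin m × Fin n)
        (⟨0, by omega⟩, ⟨j + 1, hj⟩) := fun j hj => .inl ⟨rfl, rfl⟩
    intro k
    fin_cases k
    · exact ⟨(⟨0, by omega⟩, ⟨0, by omega⟩), (⟨1, by omega⟩, ⟨0, by omega⟩),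
        .inr (.inr ⟨rfl, rfl, rfl⟩), by simp⟩
    · exact ⟨_, _, hor 0 (by omega), by simp⟩
    · exact ⟨_, _, hor 1 (by omega), by simp⟩
    · exact ⟨_, _, hor 2 (by omega), by simp⟩

/-! ### Three parts when n > 2m -/

/-- The distance from column `i + 1` to column `j` along the cycle, for a vertex `(i, j)`. -/
def shift {m n : ℕ} (x : Fin m × Fin n) : ℕ :=
  if (x.1 : ℕ) + 1 ≤ x.2 then x.2 - x.1 - 1 else x.2 + n - x.1 - 1

theorem shift_lt {m n : ℕ} (hmn : m < n) (x : Fin m × Fin n) : shift x < n := by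
  have := x.1.2
  have := x.2.2
  unfold shift; split_ifs <;> omega

theorem ext_of_shift {m n : ℕ} (hmn : m < n) {x y : Fin m × Fin n} (h : (x.1 : ℕ) = y.1)
    (hs : shift x = shift y) : x = y := by
  have h1 := x.1.2
  have h2 := x.2.2
  have h3 := y.1.2
  have h4 := y.2.2
  rw [Prod.ext_iff, Fin.ext_iff, Fin.ext_iff]
  unfold shift at hs
  refine ⟨h, ?_⟩
  split_ifs at hs <;> omega

/-- Since n is even, odd shift means white, also after wrapping. A vertical arc starts at a white
vertex, so its shift is positive and drops by one without wrapping. -/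
theorem WallArc.shift {m n : ℕ} (hmn : m < n) (hne : Even n) {x y : Fin m × Fin n}
    (h : WallArc x y) :
    ((x.1 : ℕ) = y.1 ∧ PosMatch.shift y = PosMatch.shift x + 1) ∨
    ((x.1 : ℕ) = y.1 ∧ PosMatch.shift x + 1 = n ∧ PosMatch.shift y = 0) ∨
    ((x.1 : ℕ) + 1 = y.1 ∧ PosMatch.shift x = PosMatch.shift y + 1 ∧
      PosMatch.shift x % 2 = 1) := by
  obtain ⟨N, rfl⟩ := hne
  have h1 := x.1.2
  have h2 := x.2.2
  have h3 := y.1.2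
  have h4 := y.2.2
  unfold PosMatch.shift
  rcases h with ⟨h, h'⟩ | ⟨h, h', h''⟩ | ⟨h, h', h''⟩ <;> split_ifs <;> omega

/-- A potential that increases along the arcs of the alternating orientation of the wall. -/
def potential (m i d : ℕ) : ℤ :=
  if d = 0 then - (2 * m * (m - 1)) - (2 * m - 1) - (m - i)
  else if d = 1 then - (2 * m * (m - 1)) - (2 * m - 1) - (m - i - 1)
  else - (2 * m * i) - (2 * m - 1) * ((d + 1) / 2 : ℕ)

theorem potential_zero_lt_one (m i : ℕ) : potential m i 0 < potential m i 1 := by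
  simp [potential]

theorem potential_one_le_succ_zero (m i : ℕ) : potential m i 1 ≤ potential m (i + 1) 0 := by
  simp [potential]; linarith

theorem potential_succ_le_of_even {m d : ℕ} (i : ℕ) (hm : 0 < m) (hd : d % 2 = 0) (h0 : d ≠ 0) :
    potential m i (d + 1) ≤ potential m i d := by
  unfold potential
  rw [if_neg (by omega), if_neg (by omega), if_neg (by omega), if_neg (by omega)]
  rw [show (d + 1 + 1) / 2 = (d + 1) / 2 + 1 by omega]
  push_cast
  linarith

/-- The case d = 1 needs i < m and is an equality in the last row i = m - 1. -/
theorem potential_le_succ_of_odd {m i d : ℕ} (hi : i < m) (hd : d % 2 = 1) :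
    potential m i d ≤ potential m i (d + 1) := by
  unfold potential
  rw [if_neg (by omega : d ≠ 0), if_neg (by omega : d + 1 ≠ 0), if_neg (by omega : d + 1 ≠ 1)]
  split_ifs with h1
  · subst h1
    obtain ⟨k, rfl⟩ : ∃ k, m = i + 1 + k := ⟨m - i - 1, by omega⟩
    norm_num
    nlinarith
  · rw [show (d + 1 + 1) / 2 = (d + 1) / 2 by omega]

/-- This is where n > 2m enters: n / 2 ≥ m + 1, with equality of potentials for n = 2m + 2 and i =
0. -/
theorem potential_wrap {m n : ℕ} (i : ℕ) (hmn : 2 * m < n) (hm : 2 ≤ m) (hn : n % 2 = 0) :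
    potential m i (n - 1) ≤ potential m i 0 := by
  unfold potential
  rw [if_neg (by omega), if_neg (by omega), if_pos rfl]
  obtain ⟨k, rfl⟩ : ∃ k, n = 2 * (m + 1 + k) := ⟨n / 2 - m - 1, by omega⟩
  rw [show (2 * (m + 1 + k) - 1 + 1) / 2 = m + 1 + k by omega]
  push_cast
  have : (0 : ℤ) ≤ (2 * m - 1) * k := mul_nonneg (by omega) (by omega)
  have : (0 : ℤ) ≤ m * i := by positivity
  nlinarith

/-- Going up a row gains 2m and the next odd shift costs 2m - 1, a net gain of 1 on each vertical
edge of the first part. -/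
theorem potential_succ_lt {m d : ℕ} (i : ℕ) (hd : d % 2 = 0) (h0 : d ≠ 0) :
    potential m (i + 1) d < potential m i (d + 1) := by
  unfold potential
  rw [if_neg (by omega), if_neg (by omega), if_neg (by omega), if_neg (by omega)]
  rw [show (d + 1 + 1) / 2 = (d + 1) / 2 + 1 by omega]
  push_cast
  linarith

theorem exists_isPMD_three {m n : ℕ} (hm : 2 ≤ m) (hne : Even n) (hmn : 2 * m < n) :
    ∃ E : Fin 3 → Set (Sym2 (Fin m × Fin n)), IsPMD (circularWall m n) E := by
  have hmn' : m < n := by omega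
  have hne' : n % 2 = 0 := Nat.even_iff.1 hne
  refine ⟨_, isPMD_of_arcs _ WallArc (circularWall_adj (by omega))
    -- Colour 0: the diagonal of edges from shift 0 to 1, and the vertical edges disjoint from it.
    -- The remaining edges form one path, coloured alternately 1 and 2.
    (fun x y => if (x.1 : ℕ) = y.1 then
      if shift x = 0 then 0 else if shift x % 2 = 1 then 1 else 2
      else if shift x = 1 then 2 else 0)
    ![fun x => if shift x % 2 = 1 then potential m x.1 (shift x)
        else - potential m x.1 (shift x),
      -- The absolute value is the position on that path, which runs through each row by decreasing
      -- shift from shift 0 (read as n) to shift 1, and then drops to shift 0 of the next row.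
      fun x => (if shift x % 2 = 1 then 1 else -1) *
        (n * x.1 + if shift x = 0 then (0 : ℤ) else (n : ℤ) - shift x),
      fun _ => 1] ?_ ?_ ?_ ?_ ?_ ?_⟩
  · intro x y h
    have h1 := x.1.2
    have hx := shift_lt hmn' x
    rcases h.shift hmn' hne with ⟨h, h'⟩ | ⟨h, h', h''⟩ | ⟨h, h', h''⟩
    · rw [if_pos h]
      split_ifs with e0 e1
      · simp only [Matrix.cons_val_zero, h', e0, ← h]
        simpa using potential_zero_lt_one m x.1
      · simp [h', e1, h]
        grind
      · simp
    · rw [if_pos h, if_neg (by omega), if_pos (by omega)]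
      have e1 : shift x % 2 = 1 := by omega
      simp [h'', e1, h]
      grind
    · rw [if_neg (by omega)]
      split_ifs with e1
      · simp
      · have e2 : shift y % 2 = 0 := by omega
        have := potential_succ_lt (m := m) x.1 e2 (by omega)
        simp only [Matrix.cons_val_zero, h', ← h, e2]
        simp [show (shift y + 1) % 2 = 1 by omega, this]
  · intro x y h k hk
    have h1 := x.1.2
    have hx := shift_lt hmn' x
    rcases h.shift hmn' hne with ⟨h, h'⟩ | ⟨h, h', h''⟩ | ⟨h, h', h''⟩
    · rw [if_pos h] at hk
      split_ifs at hk with e0 e1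
      · simp at hk
      · obtain rfl : k = 0 := by omega
        have := potential_le_succ_of_odd h1 e1
        simp [h', ← h, e1, show (shift x + 1) % 2 = 0 by omega, this]
      · have := potential_succ_le_of_even (m := m) x.1 (by omega) (by omega : shift x % 2 = 0) e0
        obtain rfl | rfl : k = 0 ∨ k = 1 := by omega
        · simp [h', ← h, e1, show (shift x + 1) % 2 = 1 by omega, this]
        · simp [h', ← h, e0, e1, show (shift x + 1) % 2 = 1 by omega]
    · rw [if_pos h, if_neg (by omega), if_pos (by omega)] at hk
      obtain rfl : k = 0 := by omega
      have := potential_wrap x.1 hmn hm hne'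
      simp [h'', ← h, show shift x = n - 1 by omega, show (n - 1) % 2 = 1 by omega, this]
    · rw [if_neg (by omega)] at hk
      split_ifs at hk with e1
      · have := potential_one_le_succ_zero m x.1
        obtain rfl | rfl : k = 0 ∨ k = 1 := by omega
        · simp [e1, show shift y = 0 by omega, ← h, this]
        · simp [e1, show shift y = 0 by omega, ← h, mul_add]
          linarith
      · simp at hk
  · intro x y z h h₁ hc
    have hx := shift_lt hmn' x
    have hy := shift_lt hmn' y
    have hz := shift_lt hmn' z
    refine ext_of_shift hmn' ?_ ?_ <;>
      rcases h.shift hmn' hne with ⟨h, h'⟩ | ⟨h, h', h''⟩ | ⟨h, h', h''⟩ <;>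
      rcases h₁.shift hmn' hne with ⟨h₁, h₁'⟩ | ⟨h₁, h₁', h₁''⟩ | ⟨h₁, h₁', h₁''⟩ <;> grind
  · intro x y z h h₁ hc
    have hx := shift_lt hmn' x
    have hy := shift_lt hmn' y
    have hz := shift_lt hmn' z
    refine ext_of_shift hmn' ?_ ?_ <;>
      rcases h.shift hmn' hne with ⟨h, h'⟩ | ⟨h, h', h''⟩ | ⟨h, h', h''⟩ <;>
      rcases h₁.shift hmn' hne with ⟨h₁, h₁'⟩ | ⟨h₁, h₁', h₁''⟩ | ⟨h₁, h₁', h₁''⟩ <;> grind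
  · intro x y z h h₁ hc
    have hx := shift_lt hmn' x
    have hy := shift_lt hmn' y
    have hz := shift_lt hmn' z
    refine ext_of_shift hmn' ?_ ?_ <;>
      rcases h.shift hmn' hne with ⟨h, h'⟩ | ⟨h, h', h''⟩ | ⟨h, h', h''⟩ <;>
      rcases h₁.shift hmn' hne with ⟨h₁, h₁'⟩ | ⟨h₁, h₁', h₁''⟩ | ⟨h₁, h₁', h₁''⟩ <;> grind
  · have hor : ∀ j (hj : j + 1 < n), WallArc ((⟨0, by omega⟩, ⟨j, by omega⟩) : Fin m × Fin n)
        (⟨0, by omega⟩, ⟨j + 1, hj⟩) := fun j hj => .inl ⟨rfl, rfl⟩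
    intro k
    fin_cases k
    -- In row 0, columns 1, 2, 3 have shifts 0, 1, 2.
    · exact ⟨_, _, hor 1 (by omega), by simp [shift]⟩
    · exact ⟨_, _, hor 2 (by omega), by simp [shift]⟩
    · exact ⟨_, _, hor 3 (by omega), by simp [shift]⟩

/-! ### Lower bounds: degree three and the first row -/

namespace IsPMD

variable {V : Type*} {G : SimpleGraph V} {p : ℕ} {E : Fin p → Set (Sym2 V)}

theorem exists_mem (h : IsPMD G E) {u v : V} (huv : G.Adj u v) : ∃ k, s(u, v) ∈ E k := by
  rw [← SimpleGraph.mem_edgeSet, ← h.union_eq] at huv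
  exact Set.mem_iUnion.1 huv

theorem eq_of_mem (h : IsPMD G E) {k : Fin p} {v u u' : V} (hu : s(v, u) ∈ E k)
    (hu' : s(v, u') ∈ E k) : u = u' := by
  by_contra hne
  refine (h.positive k).1.2 _ hu _ hu' (fun he => hne ?_) v ⟨by simp, by simp⟩
  rcases Sym2.eq_iff.1 he with ⟨-, h⟩ | ⟨rfl, rfl⟩
  exacts [h, rfl]

theorem exists_weight (h : IsPMD G E) (k : Fin p) : ∃ w : V → ℝ, ∀ u v, G.Adj u v →
    (∀ l < k, s(u, v) ∉ E l) → (0 < w u + w v ↔ s(u, v) ∈ E k) := by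
  obtain ⟨w, hw⟩ := (h.positive k).2
  refine ⟨w, fun u v huv hl => hw u v ?_⟩
  rw [SimpleGraph.deleteEdges_adj]
  refine ⟨huv, ?_⟩
  simpa using hl

/-- Edges at a common vertex lie in distinct parts, so three of them inject into the parts,
bijectively if p = 3. -/
theorem three_le_and_exists_mem (h : IsPMD G E) {v : V} {u : Fin 3 → V} (hu : u.Injective)
    (hv : ∀ a, G.Adj v (u a)) : 3 ≤ p ∧ (p = 3 → ∀ k, ∃ a, s(v, u a) ∈ E k) := by
  choose c hc using fun a => h.exists_mem (hv a)
  have hinj : c.Injective := fun a b hab => hu (h.eq_of_mem (hc a) (hab ▸ hc b))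
  refine ⟨by simpa using Fintype.card_le_of_injective c hinj, ?_⟩
  rintro rfl k
  obtain ⟨a, rfl⟩ := Finite.surjective_of_injective hinj k
  exact ⟨a, hc a⟩

end IsPMD

section Strip

variable {m n : ℕ}

/-- The vertex of the circular wall in row `i` whose column is the residue class of `j`. -/
def vtx (hm : 0 < m) (hn : 0 < n) (i : ℕ) (j : ℤ) : Fin m × Fin n :=
  (⟨i % m, Nat.mod_lt i hm⟩, ⟨(j % n).toNat, by
    have := Int.emod_nonneg j (b := n) (by omega)
    have := Int.emod_lt_of_pos j (b := n) (by omega)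
    omega⟩)

variable (hm : 0 < m) (hn : 0 < n)

theorem vtx_fst {i : ℕ} (hi : i < m) (j : ℤ) : ((vtx hm hn i j).1 : ℕ) = i := Nat.mod_eq_of_lt hi

theorem vtx_snd (i : ℕ) (j : ℤ) : (((vtx hm hn i j).2 : ℕ) : ℤ) = j % n :=
  Int.toNat_of_nonneg (Int.emod_nonneg j (by omega))

theorem vtx_add (i : ℕ) (j : ℤ) : vtx hm hn i (j + n) = vtx hm hn i j := by
  simp [vtx]

theorem vtx_ne_of_row {i i' : ℕ} (hi : i < m) (hi' : i' < m) (hne : i ≠ i') (j j' : ℤ) :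
    vtx hm hn i j ≠ vtx hm hn i' j' := by
  intro h
  have := congrArg (fun x : Fin m × Fin n => (x.1 : ℕ)) h
  simp only [vtx_fst hm hn hi, vtx_fst hm hn hi'] at this
  exact hne this

theorem vtx_ne_add_two (h2 : 2 < n) (i : ℕ) (j : ℤ) : vtx hm hn i j ≠ vtx hm hn i (j + 2) := by
  intro h
  have := congrArg (fun x : Fin m × Fin n => ((x.2 : ℕ) : ℤ)) h
  simp only [vtx_snd] at this
  have h' := Int.emod_eq_emod_iff_emod_sub_eq_zero.1 this.symm
  rw [add_sub_cancel_left] at h'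
  have := Int.le_of_dvd (by norm_num) (Int.dvd_of_emod_eq_zero h')
  omega

theorem vtx_hor (h4 : 4 ≤ n) (i : ℕ) (j : ℤ) :
    (circularWall m n).Adj (vtx hm hn i j) (vtx hm hn i (j + 1)) := by
  rw [circularWall_adj h4]
  left
  have h1 := vtx_snd hm hn i j
  have h2 := vtx_snd hm hn i (j + 1)
  have h3 := (vtx hm hn i j).2.2
  have h0 : 0 ≤ j % n := Int.emod_nonneg j (by omega)
  rw [← Int.emod_add_emod] at h2
  rcases lt_or_ge (j % n + 1) (n : ℤ) with h | h
  · rw [Int.emod_eq_of_lt (by omega) h] at h2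
    exact .inl ⟨rfl, by omega⟩
  · have : j % n + 1 = n := by omega
    rw [this, Int.emod_self] at h2
    exact .inr (.inl ⟨rfl, by omega, by omega⟩)

theorem vtx_ver (h4 : 4 ≤ n) (hne : Even n) {i : ℕ} (hi : i + 1 < m) {j : ℤ} (he : Even (i + j)) :
    (circularWall m n).Adj (vtx hm hn i j) (vtx hm hn (i + 1) j) := by
  rw [circularWall_adj h4]
  have h1 := vtx_snd hm hn i j
  have h2 := vtx_snd hm hn (i + 1) j
  have h3 := vtx_fst hm hn (by omega : i < m) j
  have h4 := vtx_fst hm hn hi j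
  obtain ⟨N, rfl⟩ := hne
  -- Reducing the column modulo the even number n keeps its parity.
  have h5 : j % ((N + N : ℕ) : ℤ) % 2 = j % 2 :=
    Int.emod_emod_of_dvd _ ⟨N, by push_cast; ring⟩
  rw [Int.even_iff] at he
  exact .inl (.inr (.inr ⟨by omega, by omega, by omega⟩))

theorem injective_cons_three {α : Type*} {a b c : α} (h1 : a ≠ b) (h2 : a ≠ c) (h3 : b ≠ c) :
    Function.Injective ![a, b, c] := by
  intro x y
  fin_cases x <;> fin_cases y <;> simp [h1, h2, h3, h1.symm, h2.symm, h3.symm]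

/-- The vertices in rows `i` and `i + 1` that a vertical edge joins have degree three. -/
theorem parts_at_vertical (h4 : 4 ≤ n) (hne : Even n) {p : ℕ}
    {E : Fin p → Set (Sym2 (Fin m × Fin n))} (h : IsPMD (circularWall m n) E)
    {i : ℕ} (hi : i + 1 < m) {j : ℤ} (he : Even (i + j)) : 3 ≤ p ∧ (p = 3 → ∀ k,
      (s(vtx hm hn i j, vtx hm hn i (j + 1)) ∈ E k ∨
        s(vtx hm hn i j, vtx hm hn i (j - 1)) ∈ E k ∨
        s(vtx hm hn i j, vtx hm hn (i + 1) j) ∈ E k) ∧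
      (s(vtx hm hn (i + 1) j, vtx hm hn (i + 1) (j + 1)) ∈ E k ∨
        s(vtx hm hn (i + 1) j, vtx hm hn (i + 1) (j - 1)) ∈ E k ∨
        s(vtx hm hn (i + 1) j, vtx hm hn i j) ∈ E k)) := by
  have adj : ∀ i', (circularWall m n).Adj (vtx hm hn i' j) (vtx hm hn i' (j - 1)) := by
    intro i'
    have := vtx_hor hm hn h4 i' (j - 1)
    rw [sub_add_cancel] at this
    exact this.symm
  have ne : ∀ i', vtx hm hn i' (j + 1) ≠ vtx hm hn i' (j - 1) := by
    intro i'
    have := vtx_ne_add_two hm hn (by omega) i' (j - 1)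
    rw [show j - 1 + 2 = j + 1 by ring] at this
    exact this.symm
  have hv := vtx_ver hm hn h4 hne hi he
  have hi' : i < m := by omega
  have white := h.three_le_and_exists_mem (v := vtx hm hn i j)
    (injective_cons_three (ne i) (vtx_ne_of_row hm hn hi' hi (by omega) (j + 1) j)
      (vtx_ne_of_row hm hn hi' hi (by omega) (j - 1) j))
    (by rw [Fin.forall_fin_succ, Fin.forall_fin_two]; exact ⟨vtx_hor hm hn h4 i j, adj i, hv⟩)
  have black := h.three_le_and_exists_mem (v := vtx hm hn (i + 1) j)
    (injective_cons_three (ne (i + 1)) (vtx_ne_of_row hm hn hi hi' (by omega) (j + 1) j)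
      (vtx_ne_of_row hm hn hi hi' (by omega) (j - 1) j))
    (by rw [Fin.forall_fin_succ, Fin.forall_fin_two]; exact ⟨vtx_hor hm hn h4 _ j, adj _, hv.symm⟩)
  refine ⟨white.1, fun hp k => ⟨?_, ?_⟩⟩
  · simpa [Fin.exists_fin_succ] using white.2 hp k
  · simpa [Fin.exists_fin_succ] using black.2 hp k

theorem three_le_of_isPMD (hm : 2 ≤ m) (h4 : 4 ≤ n) (hne : Even n) {p : ℕ}
    {E : Fin p → Set (Sym2 (Fin m × Fin n))} (h : IsPMD (circularWall m n) E) : 3 ≤ p :=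
  (parts_at_vertical (by omega) (by omega) h4 hne h (i := 0) (j := 0) (by omega) (by simp)).1

/-- No edge is removed before the first part, so its weight decides membership for every edge of the
wall. -/
theorem exists_wallWeight (h4 : 4 ≤ n) (hne : Even n)
    {E : Fin 3 → Set (Sym2 (Fin m × Fin n))} (h : IsPMD (circularWall m n) E) :
    ∃ W : ℕ → ℤ → ℝ, WallWeight m n W ∧ ∀ j, 0 < W 0 j + W 0 (j + 1) ↔
      s(vtx hm hn 0 j, vtx hm hn 0 (j + 1)) ∈ E 0 := by
  obtain ⟨w, hw⟩ := h.exists_weight 0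
  have hor : ∀ i j, (0 < w (vtx hm hn i j) + w (vtx hm hn i (j + 1)) ↔
      s(vtx hm hn i j, vtx hm hn i (j + 1)) ∈ E 0) := fun i j =>
    hw _ _ (vtx_hor hm hn h4 i j) (by simp)
  have hor' : ∀ i j, (0 < w (vtx hm hn i (j - 1)) + w (vtx hm hn i j) ↔
      s(vtx hm hn i j, vtx hm hn i (j - 1)) ∈ E 0) := fun i j => by
    have := hor i (j - 1)
    rwa [sub_add_cancel, Sym2.eq_swap] at this
  have ver : ∀ (i : ℕ) (j : ℤ), i + 1 < m → Even (i + j) →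
      (0 < w (vtx hm hn i j) + w (vtx hm hn (i + 1) j) ↔
        s(vtx hm hn i j, vtx hm hn (i + 1) j) ∈ E 0) := fun i j hi he =>
    hw _ _ (vtx_ver hm hn h4 hne hi he) (by simp)
  refine ⟨fun i j => w (vtx hm hn i j), ⟨?_, ?_, ?_, ?_, ?_, ?_⟩, hor 0⟩
  · intro i j
    simp only [vtx_add]
  · intro i j hi hp
    by_contra! hc
    have e : j + 2 = j + 1 + 1 := by ring
    rw [hor i j, Sym2.eq_swap] at hp
    rw [e, hor i (j + 1), ← e] at hc
    exact vtx_ne_add_two hm hn (by omega) i j (h.eq_of_mem hp hc)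
  · intro i j hi he hp
    rw [ver i j hi he] at hp
    constructor <;> by_contra! hc
    · rw [hor i j] at hc
      exact vtx_ne_of_row hm hn hi (by omega) (by omega) _ _ (h.eq_of_mem hp hc)
    · rw [hor' i j] at hc
      exact vtx_ne_of_row hm hn hi (by omega) (by omega) _ _ (h.eq_of_mem hp hc)
  · intro i j hi he hp
    rw [ver i j hi he, Sym2.eq_swap] at hp
    constructor <;> by_contra! hc
    · rw [hor _ j] at hc
      exact vtx_ne_of_row hm hn (by omega) hi (by omega) _ _ (h.eq_of_mem hp hc)
    · rw [hor' _ j] at hc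
      exact vtx_ne_of_row hm hn (by omega) hi (by omega) _ _ (h.eq_of_mem hp hc)
  · intro i j hi he
    have := ((parts_at_vertical hm hn h4 hne h hi he).2 rfl 0).1
    rwa [← hor i j, ← hor' i j, ← ver i j hi he] at this
  · intro i j hi he
    have := ((parts_at_vertical hm hn h4 hne h hi he).2 rfl 0).2
    rwa [← hor _ j, ← hor' _ j, Sym2.eq_swap (a := vtx hm hn (i + 1) j) (b := vtx hm hn i j),
      ← ver i j hi he] at this

/-- The last two parts do not contain all edges of the first row. -/
theorem exists_hor_mem_zero (h4 : 4 ≤ n)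
    {E : Fin 3 → Set (Sym2 (Fin m × Fin n))} (h : IsPMD (circularWall m n) E) :
    ∃ j, s(vtx hm hn 0 j, vtx hm hn 0 (j + 1)) ∈ E 0 := by
  by_contra! hc
  obtain ⟨w, hw⟩ := h.exists_weight 1
  set e : ℤ → Sym2 (Fin m × Fin n) := fun j => s(vtx hm hn 0 j, vtx hm hn 0 (j + 1)) with he
  have hw' : ∀ j, 0 < w (vtx hm hn 0 j) + w (vtx hm hn 0 (j + 1)) ↔ e j ∈ E 1 := fun j =>
    hw _ _ (vtx_hor hm hn h4 0 j) fun l hl => by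
      obtain rfl : l = 0 := by omega
      exact hc j
  have hor : ∀ j, e j ∈ E 1 ∨ e j ∈ E 2 := fun j => by
    obtain ⟨k, hk⟩ := h.exists_mem (vtx_hor hm hn h4 0 j)
    fin_cases k
    exacts [(hc j hk).elim, Or.inl hk, Or.inr hk]
  have hne : ∀ k j, e j ∈ E k → e (j + 1) ∉ E k := fun k j h1 h2 => by
    simp only [he] at h1 h2
    rw [Sym2.eq_swap] at h1
    have := h.eq_of_mem h1 h2
    rw [add_assoc] at this
    exact vtx_ne_add_two hm hn (by omega) 0 j this
  have alt1 : ∀ j, e j ∈ E 1 → e (j + 1) ∈ E 2 := fun j h1 =>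
    (hor (j + 1)).resolve_left (hne _ _ h1)
  have alt2 : ∀ j, e j ∈ E 2 → e (j + 1) ∈ E 1 := fun j h1 =>
    (hor (j + 1)).resolve_right (hne _ _ h1)
  obtain ⟨j, hj⟩ : ∃ j, e j ∈ E 1 := (hor 0).elim (fun h => ⟨_, h⟩) fun h => ⟨_, alt2 _ h⟩
  -- Adjacent edges of row 0 lie in different parts, so `E 1` and `E 2` alternate and the weight of
  -- `E 1` alternates in sign around the row.
  have all : ∀ t : ℕ, e (j + 2 * t) ∈ E 1 := by
    intro t
    induction t with
    | zero => simpa using hj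
    | succ t ih =>
      have := alt2 _ (alt1 _ ih)
      rwa [show j + 2 * (t : ℤ) + 1 + 1 = j + 2 * ((t + 1 : ℕ) : ℤ) by push_cast; ring] at this
  refine not_alternating_of_periodic hn (g := fun j => w (vtx hm hn 0 j))
    (fun j => by simp only [vtx_add]) j (fun t => (hw' _).2 (all t)) fun t => ?_
  have := (hw' (j + 2 * t + 1)).not.2 (hne _ _ (all t))
  rw [add_assoc _ 1 1] at this
  exact not_lt.1 this

end Strip

theorem four_le_of_isPMD {m n : ℕ} (hm : 2 ≤ m) (h4 : 4 ≤ n) (hne : Even n) (hnm : n ≤ 2 * m)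
    {p : ℕ} {E : Fin p → Set (Sym2 (Fin m × Fin n))} (h : IsPMD (circularWall m n) E) :
    4 ≤ p := by
  have h3 := three_le_of_isPMD hm h4 hne h
  by_contra! hlt
  obtain rfl : p = 3 := by omega
  have hm0 : 0 < m := by omega
  have hn0 : 0 < n := by omega
  obtain ⟨W, hW, h0⟩ := exists_wallWeight hm0 hn0 h4 hne h
  obtain ⟨j, hj⟩ := exists_hor_mem_zero hm0 hn0 h4 h
  exact not_lt.2 (hW.hor_nonpos hn0 hne hnm j) ((h0 j).2 hj)

end PosMatch

theorem mainTheorem10 (m n : ℕ) (hm : 2 ≤ m) (hn : 4 ≤ n) (hn_even : Even n) :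
    (2 * m < n → PosMatch.pmd (PosMatch.circularWall m n) = 3) ∧
    (n ≤ 2 * m → PosMatch.pmd (PosMatch.circularWall m n) = 4) := by
  constructor <;> intro h
  · refine le_antisymm (Nat.sInf_le (PosMatch.exists_isPMD_three hm hn_even h))
      (le_csInf ⟨3, PosMatch.exists_isPMD_three hm hn_even h⟩ ?_)
    rintro p ⟨E, hE⟩
    exact PosMatch.three_le_of_isPMD hm hn hn_even hE
  · refine le_antisymm (Nat.sInf_le (PosMatch.exists_isPMD_four hm hn hn_even))
      (le_csInf ⟨4, PosMatch.exists_isPMD_four hm hn hn_even⟩ ?_)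
    rintro p ⟨E, hE⟩
    exact PosMatch.four_le_of_isPMD hm hn hn_even h hE
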